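/- Let $n\ge 0$ be an integer and let $c\in\mathbb{C}$, $c\neq 0$. Let $H_{0,c}$ be the rational Cherednik algebra of $S_n$ acting on $\mathfrak{h}=\mathbb{C}^n$ by permuting coordinates, at $t=0$. That is, $H_{0,c}$ is the quotient of the semidirect (smash) product $S_n\ltimes\mathbb{C}\langle x_1,\dots,x_n,y_1,\dots,y_n\rangle$, in which $\sigma x_i\sigma^{-1}=x_{\sigma(i)}$ and $\sigma y_i\sigma^{-1}=y_{\sigma(i)}$ for $\sigma\in S_n$, by the relations $$[x_i,x_j]=[y_i,y_j]=0\ \text{ for all } i,j,\qquad [y_i,x_j]=c\,s_{ij}\ \text{ for } i\neq j,\qquad [y_i,x_i]=-c\sum_{j\neq i}s_{ij},$$ where $s_{ij}\in S_n$ is the transposition of $i$ and $j$. Then every irreducible representation $E$ of $H_{0,c}$ (of a priori arbitrary dimension) is finite dimensional over $\mathbb{C}$, with $\dim_{\mathbb{C}}E=n!$, and the restriction of $E$ to $S_n$ is isomorphic to the regular representation $\mathbb{C}[S_n]$. -/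

import Mathlib

/-- Generators of the rational Cherednik algebra of `S_n` acting on `ℂⁿ`: the group elements
`g σ`, the coordinate functions `x i` (the standard basis of `𝔥*`) and the vectors `y i`
(the dual basis of `𝔥 = ℂⁿ`). -/
inductive CherednikGen (n : ℕ) : Type
  | g : Equiv.Perm (Fin n) → CherednikGen n
  | x : Fin n → CherednikGen n
  | y : Fin n → CherednikGen n

namespace CherednikGen

/-- A group element, seen in the free algebra on the generators. -/
noncomputable def G {n : ℕ} (σ : Equiv.Perm (Fin n)) : FreeAlgebra ℂ (CherednikGen n) :=
  FreeAlgebra.ι ℂ (g σ)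

/-- The generator `x_i`, seen in the free algebra on the generators. -/
noncomputable def X {n : ℕ} (i : Fin n) : FreeAlgebra ℂ (CherednikGen n) :=
  FreeAlgebra.ι ℂ (x i)

/-- The generator `y_i`, seen in the free algebra on the generators. -/
noncomputable def Y {n : ℕ} (i : Fin n) : FreeAlgebra ℂ (CherednikGen n) :=
  FreeAlgebra.ι ℂ (y i)

end CherednikGen

open CherednikGen in
/-- Defining relations of the rational Cherednik algebra `H_{t,c}` of `S_n`, `𝔥 = ℂⁿ`.
The first four families present the smash product `S_n ⋉ ℂ⟨x_1,…,x_n,y_1,…,y_n⟩`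
(with `σ x_i σ⁻¹ = x_{σ(i)}` and `σ y_i σ⁻¹ = y_{σ(i)}`); the others are
`[x_i,x_j] = [y_i,y_j] = 0`, `[y_i,x_j] = c s_{ij}` for `i ≠ j`, and
`[y_i,x_i] = t - c ∑_{j ≠ i} s_{ij}`. -/
inductive CherednikRel (n : ℕ) (t c : ℂ) :
    FreeAlgebra ℂ (CherednikGen n) → FreeAlgebra ℂ (CherednikGen n) → Prop
  | one : CherednikRel n t c (G 1) 1
  | mul (σ τ : Equiv.Perm (Fin n)) : CherednikRel n t c (G (σ * τ)) (G σ * G τ)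
  | gx (σ : Equiv.Perm (Fin n)) (i : Fin n) : CherednikRel n t c (G σ * X i) (X (σ i) * G σ)
  | gy (σ : Equiv.Perm (Fin n)) (i : Fin n) : CherednikRel n t c (G σ * Y i) (Y (σ i) * G σ)
  | xx (i j : Fin n) : CherednikRel n t c (X i * X j) (X j * X i)
  | yy (i j : Fin n) : CherednikRel n t c (Y i * Y j) (Y j * Y i)
  | yx_ne (i j : Fin n) (h : i ≠ j) :
      CherednikRel n t c (Y i * X j - X j * Y i) (c • G (Equiv.swap i j))
  | yx_eq (i : Fin n) :
      CherednikRel n t c (Y i * X i - X i * Y i)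
        (algebraMap ℂ _ t - c • ∑ j ∈ Finset.univ.erase i, G (Equiv.swap i j))

/-- The rational Cherednik algebra `H_{t,c}` of `S_n` with `𝔥 = ℂⁿ`. -/
abbrev RationalCherednikAlgebra (n : ℕ) (t c : ℂ) : Type :=
  RingQuot (CherednikRel n t c)

/-- The canonical homomorphism from `S_n` to the multiplicative monoid of `H_{t,c}`. -/
noncomputable def RationalCherednikAlgebra.ofPerm (n : ℕ) (t c : ℂ) :
    Equiv.Perm (Fin n) →* RationalCherednikAlgebra n t c where
  toFun σ := RingQuot.mkAlgHom ℂ (CherednikRel n t c) (CherednikGen.G σ)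
  map_one' := by
    rw [RingQuot.mkAlgHom_rel ℂ CherednikRel.one, map_one]
  map_mul' σ τ := by
    rw [RingQuot.mkAlgHom_rel ℂ (CherednikRel.mul σ τ), map_mul]

/-- The restriction of a representation `E` of `H_{t,c}` to `S_n`: the permutation `σ` acts on `E`
as the corresponding element of `H_{t,c}`. -/
noncomputable def RationalCherednikAlgebra.permRep (n : ℕ) (t c : ℂ) (E : Type*) [AddCommGroup E]
    [Module ℂ E] [Module (RationalCherednikAlgebra n t c) E]
    [IsScalarTower ℂ (RationalCherednikAlgebra n t c) E] :
    Representation ℂ (Equiv.Perm (Fin n)) E :=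
  (Algebra.lsmul ℂ ℂ E : RationalCherednikAlgebra n t c →ₐ[ℂ] Module.End ℂ E).toMonoidHom.comp
    (RationalCherednikAlgebra.ofPerm n t c)

/-! The proof computes the character of `E` on S_n, then its total dimension. If σ ≠ 1 moves j,
write σ = s τ with s the transposition of σ(j) and j, so that τ fixes j. The relation for [y_{σ(j)},
x_j] turns cσ into the commutator [y_{σ(j)} τ, x_j], so σ has trace zero since c ≠ 0. Hence dim E =
n! · dim E^{S_n}, and it remains to see that `E` is finite dimensional and that its invariants have
dimension at most one.

Finiteness: symmetric polynomials in the x_i alone, or in the y_i alone, are central. The algebra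
has countable dimension, so by Dixmier's form of Schur's lemma they act on `E` by scalars. Each x_i
and each y_i is therefore algebraic on `E`. As the algebra is spanned by products (polynomial in
x)(polynomial in y)σ, its image in End(E) is finite dimensional, and `E` is the orbit of any nonzero
vector under this image.

Invariants: let e be the symmetrizer. If the spherical algebra eHe is commutative, an eigenvector
argument shows that it acts on eE by scalars, and simplicity gives dim eE ≤ 1. Commutativity comes
from the classical Dunkl representation on ℂ(x)[p], in which y_i acts by p_i + c ∑ (x_i - x_k)⁻¹
s_{ik}. Multiplication by an S_n-invariant commutes with this action, so (eae)(ebe) sends 1 to a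
product of two elements of a commutative ring. Comparing leading terms in p shows that only 0 in He
kills the vector 1. -/

/-! ### Polynomials in commuting elements of a noncommutative algebra -/

open MvPolynomial in
/-- Evaluation of polynomials at a family of pairwise commuting elements of an algebra. -/
noncomputable def commAeval {A : Type*} [Ring A] [Algebra ℂ A] {ι : Type*} (x : ι → A)
    (hx : ∀ i j, x i * x j = x j * x i) : MvPolynomial ι ℂ →ₐ[ℂ] A :=
  haveI : IsMulCommutative (Algebra.adjoin ℂ (Set.range x)) :=
    Algebra.isMulCommutative_adjoin ℂ (by rintro _ ⟨i, rfl⟩ _ ⟨j, rfl⟩; exact hx i j)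
  letI : CommSemiring (Algebra.adjoin ℂ (Set.range x)) :=
    { (inferInstance : Semiring (Algebra.adjoin ℂ (Set.range x))) with
      mul_comm := fun a b => this.1.comm a b }
  (Algebra.adjoin ℂ (Set.range x)).val.comp
    (aeval fun i => (⟨x i, Algebra.subset_adjoin ⟨i, rfl⟩⟩ : Algebra.adjoin ℂ (Set.range x)))

section commAeval

open MvPolynomial

variable {A : Type*} [Ring A] [Algebra ℂ A] {ι : Type*} (x : ι → A)
    (hx : ∀ i j, x i * x j = x j * x i)

@[simp]
theorem commAeval_X (i : ι) : commAeval x hx (X i) = x i := by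
  simp [commAeval]

@[simp]
theorem commAeval_C (a : ℂ) : commAeval x hx (C a) = algebraMap ℂ A a :=
  (commAeval x hx).commutes a

theorem commAeval_semiconj {a : A} (τ : ι → ι) (h : ∀ i, a * x i = x (τ i) * a)
    (f : MvPolynomial ι ℂ) : a * commAeval x hx f = commAeval x hx (rename τ f) * a := by
  induction f using MvPolynomial.induction_on with
  | C r => simp [Algebra.commutes]
  | add p q hp hq => simp [mul_add, add_mul, hp, hq]
  | mul_X p i hp => rw [map_mul, map_mul, ← mul_assoc, hp, map_mul, rename_X, mul_assoc,
      commAeval_X, h, commAeval_X, mul_assoc]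

theorem commAeval_commute {a : A} (h : ∀ i, a * x i = x i * a)
    (f : MvPolynomial ι ℂ) : a * commAeval x hx f = commAeval x hx f * a := by
  simpa using commAeval_semiconj x hx (a := a) id h f

theorem map_commAeval {B : Type*} [Ring B] [Algebra ℂ B] (ψ : A →ₐ[ℂ] B)
    (f : MvPolynomial ι ℂ) : ψ (commAeval x hx f) =
      commAeval (fun i => ψ (x i)) (fun i j => by rw [← map_mul, hx, map_mul]) f := by
  induction f using MvPolynomial.induction_on with
  | C r => simp
  | add p q hp hq => simp [hp, hq]
  | mul_X p i hp => simp [hp]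

end commAeval

/-! ### Cherednik relations, central symmetric polynomials, ordered products -/

/-- A homomorphism from `S_n` and two families `x`, `y` in a `ℂ`-algebra satisfying the relations
of the rational Cherednik algebra `H_{0,c}`. -/
structure IsCherednikTriple {A : Type*} [Ring A] [Algebra ℂ A] {n : ℕ} (c : ℂ)
    (g : Equiv.Perm (Fin n) →* A) (x y : Fin n → A) : Prop where
  gx (σ i) : g σ * x i = x (σ i) * g σ
  gy (σ i) : g σ * y i = y (σ i) * g σ
  xx (i j) : x i * x j = x j * x i
  yy (i j) : y i * y j = y j * y i
  yx_ne (i j) : i ≠ j → y i * x j - x j * y i = c • g (Equiv.swap i j)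
  yx_eq (i) : y i * x i - x i * y i = -(c • ∑ j ∈ Finset.univ.erase i, g (Equiv.swap i j))

namespace IsCherednikTriple

open MvPolynomial

variable {A : Type*} [Ring A] [Algebra ℂ A] {n : ℕ} {c : ℂ}
    {g : Equiv.Perm (Fin n) →* A} {x y : Fin n → A}

/-- The relations are preserved by exchanging `x` and `y` and negating `c`. -/
theorem exchange (T : IsCherednikTriple c g x y) : IsCherednikTriple (-c) g y x where
  gx := T.gy
  gy := T.gx
  xx := T.yy
  yy := T.xx
  yx_ne i j h := by
    rw [← neg_sub, T.yx_ne j i h.symm, Equiv.swap_comm, neg_smul]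
  yx_eq i := by
    rw [← neg_sub, T.yx_eq i, neg_smul]

theorem map (T : IsCherednikTriple c g x y) {B : Type*} [Ring B] [Algebra ℂ B] (ψ : A →ₐ[ℂ] B) :
    IsCherednikTriple c ((ψ : A →* B).comp g) (fun i => ψ (x i)) (fun i => ψ (y i)) where
  gx σ i := by simp [← map_mul, T.gx]
  gy σ i := by simp [← map_mul, T.gy]
  xx i j := by simp [← map_mul, T.xx i]
  yy i j := by simp [← map_mul, T.yy i]
  yx_ne i j h := by simp [← map_mul, ← map_sub, T.yx_ne i j h]
  yx_eq i := by
    rw [← map_mul, ← map_mul, ← map_sub, T.yx_eq i, map_neg, map_smul, map_sum]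
    rfl

/-- The commutator of `y_i` with a polynomial in the `x_j` is given by divided differences. -/
theorem exists_commutator (T : IsCherednikTriple c g x y) (i : Fin n) (f : MvPolynomial (Fin n) ℂ) :
    ∃ d : Fin n → MvPolynomial (Fin n) ℂ,
      (∀ j, j ≠ i → (X i - X j) * d j = f - rename (Equiv.swap i j) f) ∧
      y i * commAeval x T.xx f - commAeval x T.xx f * y i =
        -(c • ∑ j ∈ Finset.univ.erase i, commAeval x T.xx (d j) * g (Equiv.swap i j)) := by
  induction f using MvPolynomial.induction_on with
  | C r => exact ⟨0, by simp, by simp [Algebra.commutes]⟩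
  | add p q hp hq =>
    obtain ⟨d, hd, hd'⟩ := hp
    obtain ⟨e, he, he'⟩ := hq
    refine ⟨d + e, fun j hj => ?_, ?_⟩
    · rw [Pi.add_apply, mul_add, hd j hj, he j hj, map_add]; ring
    · simp only [map_add, mul_add, add_mul, Pi.add_apply, Finset.sum_add_distrib, smul_add,
        neg_add, ← hd', ← he']
      abel
  | mul_X p k hp =>
    obtain ⟨d, hd, hd'⟩ := hp
    have hX : ∃ e : Fin n → MvPolynomial (Fin n) ℂ,
        (∀ j, j ≠ i → (X i - X j) * e j = X k - rename (Equiv.swap i j) (X k)) ∧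
        y i * x k - x k * y i =
        -(c • ∑ j ∈ Finset.univ.erase i, commAeval x T.xx (e j) * g (Equiv.swap i j)) := by
      -- The divided difference of X_k along s_{ij} is 1 if k = i; for k ≠ i it is -1 at j = k and 0
      -- at the other j. The value at j = i is never used.
      by_cases hk : i = k
      · subst hk
        refine ⟨1, fun j hj => by simp, by simp [T.yx_eq]⟩
      · refine ⟨Pi.single k (-1), fun j hj => ?_, ?_⟩
        · rcases eq_or_ne j k with rfl | h
          · simp
          · simp [h, Equiv.swap_apply_of_ne_of_ne (Ne.symm hk) h.symm]
        · rw [T.yx_ne i k hk, Finset.sum_eq_single k]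
          · simp
          · intro b _ hb; simp [hb]
          · simp [Ne.symm hk]
    obtain ⟨e, he, he'⟩ := hX
    -- Twisted Leibniz rule: the transposition acts on X_k because s_{ij} has to be moved to the
    -- right past x_k.
    refine ⟨fun j => d j * rename (Equiv.swap i j) (X k) + p * e j, fun j hj => ?_, ?_⟩
    · rw [map_mul]
      linear_combination rename (Equiv.swap i j) (X k) * hd j hj + p * he j hj
    · have key : y i * commAeval x T.xx (p * X k) - commAeval x T.xx (p * X k) * y i =
          (y i * commAeval x T.xx p - commAeval x T.xx p * y i) * x k +
          commAeval x T.xx p * (y i * x k - x k * y i) := by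
        rw [map_mul, commAeval_X]; noncomm_ring
      rw [key, hd', he', neg_mul, mul_neg, smul_mul_assoc, mul_smul_comm, ← neg_add, ← smul_add,
        Finset.sum_mul, Finset.mul_sum, ← Finset.sum_add_distrib]
      congr 2
      refine Finset.sum_congr rfl fun j _ => ?_
      rw [map_add, map_mul, map_mul, add_mul, rename_X, commAeval_X, mul_assoc, mul_assoc, T.gx,
        mul_assoc]

/-- Symmetric polynomials in the `x_j` commute with the `y_i`. -/
theorem y_commute_of_isSymmetric (T : IsCherednikTriple c g x y) {f : MvPolynomial (Fin n) ℂ}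
    (hf : f.IsSymmetric) (i : Fin n) :
    y i * commAeval x T.xx f = commAeval x T.xx f * y i := by
  obtain ⟨d, hd, hd'⟩ := T.exists_commutator i f
  rw [← sub_eq_zero, hd', Finset.sum_eq_zero, smul_zero, neg_zero]
  intro j hj
  have h0 : d j = 0 := by
    have := hd j (Finset.ne_of_mem_erase hj)
    rw [hf, sub_self] at this
    refine (mul_eq_zero.1 this).resolve_left ?_
    exact fun h => (Finset.ne_of_mem_erase hj) (X_injective (sub_eq_zero.1 h)).symm
  simp [h0]

theorem g_commute_of_isSymmetric (T : IsCherednikTriple c g x y) {f : MvPolynomial (Fin n) ℂ}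
    (hf : f.IsSymmetric) (σ : Equiv.Perm (Fin n)) :
    g σ * commAeval x T.xx f = commAeval x T.xx f * g σ := by
  rw [commAeval_semiconj x T.xx σ (T.gx σ), hf]

/-- The span of the ordered products (polynomial in `x`)·(polynomial in `y`)·(element of `V`). -/
def orderedSpan (T : IsCherednikTriple c g x y) (V : Submodule ℂ A) : Submodule ℂ A :=
  Submodule.span ℂ {a | ∃ f h, ∃ v ∈ V, a = commAeval x T.xx f * commAeval y T.yy h * v}

theorem mem_orderedSpan (T : IsCherednikTriple c g x y) {V : Submodule ℂ A} {v : A} (hv : v ∈ V)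
    (f h) : commAeval x T.xx f * commAeval y T.yy h * v ∈ T.orderedSpan V :=
  Submodule.subset_span ⟨f, h, v, hv, rfl⟩

theorem x_mul_mem_orderedSpan (T : IsCherednikTriple c g x y) {V : Submodule ℂ A} (i : Fin n)
    {a : A} (ha : a ∈ T.orderedSpan V) : x i * a ∈ T.orderedSpan V := by
  suffices T.orderedSpan V ≤ (T.orderedSpan V).comap (LinearMap.mulLeft ℂ (x i)) from this ha
  refine Submodule.span_le.2 ?_
  rintro _ ⟨f, h, v, hv, rfl⟩
  have := T.mem_orderedSpan hv (X i * f) h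
  rw [map_mul, commAeval_X] at this
  simpa [mul_assoc] using this

theorem g_mul_mem_orderedSpan (T : IsCherednikTriple c g x y) {V : Submodule ℂ A}
    (hV : ∀ σ, ∀ v ∈ V, g σ * v ∈ V) (σ : Equiv.Perm (Fin n))
    {a : A} (ha : a ∈ T.orderedSpan V) : g σ * a ∈ T.orderedSpan V := by
  suffices T.orderedSpan V ≤ (T.orderedSpan V).comap (LinearMap.mulLeft ℂ (g σ)) from this ha
  refine Submodule.span_le.2 ?_
  rintro _ ⟨f, h, v, hv, rfl⟩
  have := T.mem_orderedSpan (hV σ v hv) (rename σ f) (rename σ h)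
  change g σ * (commAeval x T.xx f * commAeval y T.yy h * v) ∈ T.orderedSpan V
  rwa [← mul_assoc, ← mul_assoc, commAeval_semiconj x T.xx σ (T.gx σ), mul_assoc _ (g σ),
    commAeval_semiconj y T.yy σ (T.gy σ), ← mul_assoc, mul_assoc _ (g σ)]

/-- Moving y_i to the right past a polynomial in x costs only terms (polynomial in x) s_{ij}; the
transposition then passes through the y-part and is absorbed by `V`. -/
theorem y_mul_mem_orderedSpan (T : IsCherednikTriple c g x y) {V : Submodule ℂ A}
    (hV : ∀ σ, ∀ v ∈ V, g σ * v ∈ V) (i : Fin n)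
    {a : A} (ha : a ∈ T.orderedSpan V) : y i * a ∈ T.orderedSpan V := by
  suffices T.orderedSpan V ≤ (T.orderedSpan V).comap (LinearMap.mulLeft ℂ (y i)) from this ha
  refine Submodule.span_le.2 ?_
  rintro _ ⟨f, h, v, hv, rfl⟩
  obtain ⟨d, -, hd⟩ := T.exists_commutator i f
  rw [sub_eq_iff_eq_add] at hd
  change y i * (commAeval x T.xx f * commAeval y T.yy h * v) ∈ T.orderedSpan V
  rw [← mul_assoc, ← mul_assoc, hd, add_mul, add_mul, neg_mul, neg_mul, smul_mul_assoc,
    smul_mul_assoc, Finset.sum_mul, Finset.sum_mul]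
  refine add_mem (neg_mem (Submodule.smul_mem _ _ (sum_mem fun j _ => ?_))) ?_
  · rw [mul_assoc _ (g _), commAeval_semiconj y T.yy _ (T.gy _), ← mul_assoc, mul_assoc _ (g _)]
    exact T.mem_orderedSpan (hV _ v hv) _ _
  · have := T.mem_orderedSpan hv f (X i * h)
    rw [map_mul, commAeval_X] at this
    simpa [mul_assoc] using this

end IsCherednikTriple

/-! ### The presented algebra and its universal property -/

namespace RationalCherednikAlgebra

variable {n : ℕ} {t c : ℂ}

/-- The image of `x_i` in `H_{t,c}`. -/
noncomputable def x (n : ℕ) (t c : ℂ) (i : Fin n) : RationalCherednikAlgebra n t c :=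
  RingQuot.mkAlgHom ℂ (CherednikRel n t c) (CherednikGen.X i)

/-- The image of `y_i` in `H_{t,c}`. -/
noncomputable def y (n : ℕ) (t c : ℂ) (i : Fin n) : RationalCherednikAlgebra n t c :=
  RingQuot.mkAlgHom ℂ (CherednikRel n t c) (CherednikGen.Y i)

@[elab_as_elim]
theorem induction {P : RationalCherednikAlgebra n t c → Prop}
    (algebraMap : ∀ r : ℂ, P (algebraMap ℂ _ r)) (ofPerm : ∀ σ, P (ofPerm n t c σ))
    (x : ∀ i, P (x n t c i)) (y : ∀ i, P (y n t c i))
    (add : ∀ a b, P a → P b → P (a + b)) (mul : ∀ a b, P a → P b → P (a * b))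
    (a : RationalCherednikAlgebra n t c) : P a := by
  obtain ⟨a, rfl⟩ := RingQuot.mkAlgHom_surjective ℂ (CherednikRel n t c) a
  induction a using FreeAlgebra.induction with
  | grade0 r => rw [AlgHom.commutes]; exact algebraMap r
  | grade1 k =>
    cases k with
    | g σ => exact ofPerm σ
    | x i => exact x i
    | y i => exact y i
  | mul a b ha hb => rw [map_mul]; exact mul _ _ ha hb
  | add a b ha hb => rw [map_add]; exact add _ _ ha hb

theorem isCherednikTriple (n : ℕ) (c : ℂ) :
    IsCherednikTriple c (ofPerm n 0 c) (x n 0 c) (y n 0 c) where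
  gx σ i := by
    simpa [ofPerm, x, y] using RingQuot.mkAlgHom_rel ℂ (CherednikRel.gx (t := 0) (c := c) σ i)
  gy σ i := by
    simpa [ofPerm, x, y] using RingQuot.mkAlgHom_rel ℂ (CherednikRel.gy (t := 0) (c := c) σ i)
  xx i j := by
    simpa [ofPerm, x, y] using RingQuot.mkAlgHom_rel ℂ (CherednikRel.xx (t := 0) (c := c) i j)
  yy i j := by
    simpa [ofPerm, x, y] using RingQuot.mkAlgHom_rel ℂ (CherednikRel.yy (t := 0) (c := c) i j)
  yx_ne i j h := by
    simpa [ofPerm, x, y] using RingQuot.mkAlgHom_rel ℂ (CherednikRel.yx_ne (t := 0) (c := c) i j h)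
  yx_eq i := by
    simpa [ofPerm, x, y] using RingQuot.mkAlgHom_rel ℂ (CherednikRel.yx_eq (t := 0) (c := c) i)

/-- This is the spanning half of a PBW theorem. It is used with `V` the span of S_n, for finiteness,
and with `V` the line of the symmetrizer, for faithfulness on He. -/
theorem mul_mem_orderedSpan {V : Submodule ℂ (RationalCherednikAlgebra n 0 c)}
    (hV : ∀ σ, ∀ v ∈ V, ofPerm n 0 c σ * v ∈ V) (a : RationalCherednikAlgebra n 0 c)
    {b} (hb : b ∈ (isCherednikTriple n c).orderedSpan V) :
    a * b ∈ (isCherednikTriple n c).orderedSpan V := by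
  induction a using induction generalizing b with
  | algebraMap r => rw [← Algebra.smul_def]; exact Submodule.smul_mem _ _ hb
  | ofPerm σ => exact (isCherednikTriple n c).g_mul_mem_orderedSpan hV σ hb
  | x i => exact (isCherednikTriple n c).x_mul_mem_orderedSpan i hb
  | y i => exact (isCherednikTriple n c).y_mul_mem_orderedSpan hV i hb
  | add a a' ha ha' => rw [add_mul]; exact add_mem (ha hb) (ha' hb)
  | mul a a' ha ha' => rw [mul_assoc]; exact ha (ha' hb)

/-- The universal property of `H_{0,c}`. -/
noncomputable def lift {A : Type*} [Ring A] [Algebra ℂ A]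
    {g : Equiv.Perm (Fin n) →* A} {x' y' : Fin n → A} (T : IsCherednikTriple c g x' y') :
    RationalCherednikAlgebra n 0 c →ₐ[ℂ] A :=
  RingQuot.liftAlgHom ℂ ⟨FreeAlgebra.lift ℂ fun
    | .g σ => g σ
    | .x i => x' i
    | .y i => y' i, by
    intro a b h
    induction h with
    | one => simp [CherednikGen.G]
    | mul σ τ => simp [CherednikGen.G]
    | gx σ i => simp [CherednikGen.G, CherednikGen.X, T.gx]
    | gy σ i => simp [CherednikGen.G, CherednikGen.Y, T.gy]
    | xx i j => simp [CherednikGen.X, T.xx i]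
    | yy i j => simp [CherednikGen.Y, T.yy i]
    | yx_ne i j h => simp [CherednikGen.X, CherednikGen.Y, CherednikGen.G, T.yx_ne i j h]
    | yx_eq i => simp [CherednikGen.X, CherednikGen.Y, CherednikGen.G, T.yx_eq i]⟩

section lift

variable {A : Type*} [Ring A] [Algebra ℂ A]
    {g : Equiv.Perm (Fin n) →* A} {x' y' : Fin n → A} (T : IsCherednikTriple c g x' y')

@[simp]
theorem lift_ofPerm (σ) : lift T (ofPerm n 0 c σ) = g σ := by
  simp [lift, ofPerm, CherednikGen.G]

@[simp]
theorem lift_x (i) : lift T (x n 0 c i) = x' i := by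
  simp [lift, x, CherednikGen.X]

@[simp]
theorem lift_y (i) : lift T (y n 0 c i) = y' i := by
  simp [lift, y, CherednikGen.Y]

end lift

end RationalCherednikAlgebra

/-! ### Dunkl operators and their commutativity -/

namespace IsCherednikTriple

/-- The commutators `[y_i, y_j]` commute with the `x_k` as a consequence of the other relations. -/
theorem commutator_y_mul_x {A : Type*} [Ring A] [Algebra ℂ A] {n : ℕ} {c : ℂ}
    {g : Equiv.Perm (Fin n) →* A} {x y : Fin n → A}
    (gy : ∀ σ i, g σ * y i = y (σ i) * g σ)
    (yx_ne : ∀ i j, i ≠ j → y i * x j - x j * y i = c • g (Equiv.swap i j))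
    (yx_eq : ∀ i, y i * x i - x i * y i = -(c • ∑ j ∈ Finset.univ.erase i, g (Equiv.swap i j)))
    (i j k : Fin n) : (y i * y j - y j * y i) * x k = x k * (y i * y j - y j * y i) := by
  have jacobi : ∀ i j k, (y i * y j - y j * y i) * x k - x k * (y i * y j - y j * y i) =
      (y i * (y j * x k - x k * y j) - (y j * x k - x k * y j) * y i) -
      (y j * (y i * x k - x k * y i) - (y i * x k - x k * y i) * y j) := by
    intro i j k; noncomm_ring
  have hcomm : ∀ a b l, l ≠ a → l ≠ b → y l * g (Equiv.swap a b) = g (Equiv.swap a b) * y l := by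
    intro a b l ha hb
    rw [gy, Equiv.swap_apply_of_ne_of_ne ha hb]
  -- In [y_i, [y_j, x_j]] only the transposition s_{ij} fails to commute with y_i, and its
  -- contribution cancels that of [y_j, [y_i, x_j]].
  have heq : ∀ i j, i ≠ j → (y i * y j - y j * y i) * x j = x j * (y i * y j - y j * y i) := by
    intro i j hij
    rw [← sub_eq_zero, jacobi, yx_eq, yx_ne i j hij]
    have h1 : y i * ∑ l ∈ Finset.univ.erase j, g (Equiv.swap j l) -
        (∑ l ∈ Finset.univ.erase j, g (Equiv.swap j l)) * y i =
        y i * g (Equiv.swap i j) - y j * g (Equiv.swap i j) := by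
      rw [Finset.mul_sum, Finset.sum_mul, ← Finset.sum_sub_distrib, Finset.sum_eq_single i]
      · rw [gy, Equiv.swap_apply_right, Equiv.swap_comm]
      · intro l hl hli
        rw [hcomm j l i hij hli.symm, sub_self]
      · simp [hij]
    have h2 : g (Equiv.swap i j) * y j = y i * g (Equiv.swap i j) := by
      rw [gy, Equiv.swap_apply_right]
    rw [mul_neg, neg_mul, mul_smul_comm, smul_mul_assoc, mul_smul_comm, smul_mul_assoc, h2,
      neg_sub_neg, ← smul_sub, ← smul_sub, ← neg_sub (y i * _), h1, neg_sub, sub_self]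
  rcases eq_or_ne i j with rfl | hij
  · simp
  rcases eq_or_ne j k with rfl | hjk
  · exact heq i j hij
  rcases eq_or_ne i k with rfl | hik
  · have := heq j i hij.symm
    rw [← neg_sub, neg_mul, this, mul_neg]
  · rw [← sub_eq_zero, jacobi, yx_ne j k hjk, yx_ne i k hik, mul_smul_comm, mul_smul_comm,
      smul_mul_assoc, smul_mul_assoc, hcomm j k i hij hik, hcomm i k j hij.symm hjk]
    simp

end IsCherednikTriple

namespace Dunkl

open MvPolynomial

variable {n : ℕ} (c : ℂ) (K : Type*) [Field K] [Algebra ℂ K] [Algebra (MvPolynomial (Fin n) ℂ) K]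
  [IsFractionRing (MvPolynomial (Fin n) ℂ) K] [IsScalarTower ℂ (MvPolynomial (Fin n) ℂ) K]

/-- The coordinate functions, as rational functions. -/
noncomputable def coord (i : Fin n) : K := algebraMap (MvPolynomial (Fin n) ℂ) K (X i)

omit [Algebra ℂ K] [IsScalarTower ℂ (MvPolynomial (Fin n) ℂ) K] in
theorem coord_injective : Function.Injective (coord K : Fin n → K) :=
  (IsFractionRing.injective (MvPolynomial (Fin n) ℂ) K).comp X_injective

/-- The action of `S_n` on rational functions. -/
noncomputable def permField : Equiv.Perm (Fin n) →* (K ≃ₐ[ℂ] K) :=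
  (IsFractionRing.fieldEquivOfAlgEquivHom (B := MvPolynomial (Fin n) ℂ) (A := ℂ) ℂ K).comp
    { toFun := fun σ => renameEquiv ℂ σ
      map_one' := by ext; simp
      map_mul' := fun σ τ => by ext; simp }

@[simp]
theorem permField_coord (σ : Equiv.Perm (Fin n)) (i : Fin n) :
    permField K σ (coord K i) = coord K (σ i) := by
  simp [permField, coord]

/-- The diagonal action of `S_n` on polynomials in the momenta over the rational functions of the
coordinates. -/
noncomputable def perm : Equiv.Perm (Fin n) →* (MvPolynomial (Fin n) K →ₐ[ℂ] MvPolynomial (Fin n) K)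
    where
  toFun σ := ((rename σ).restrictScalars ℂ).comp (mapAlgHom (permField K σ : K →ₐ[ℂ] K))
  map_one' := by
    refine AlgHom.ext fun p => ?_
    induction p using MvPolynomial.induction_on with
    | C r => simp
    | add p q hp hq => rw [map_add, hp, hq, map_add]
    | mul_X p i hp => rw [map_mul, hp, map_mul]; simp
  map_mul' σ τ := by
    refine AlgHom.ext fun p => ?_
    induction p using MvPolynomial.induction_on with
    | C r => simp
    | add p q hp hq => rw [map_add, hp, hq, map_add]
    | mul_X p i hp => rw [map_mul, hp, map_mul]; simp

theorem perm_apply (σ : Equiv.Perm (Fin n)) (p : MvPolynomial (Fin n) K) :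
    perm K σ p = rename σ (map (permField K σ : K →+* K) p) := rfl

@[simp]
theorem perm_C (σ : Equiv.Perm (Fin n)) (r : K) : perm K σ (C r) = C (permField K σ r) := by
  simp [perm_apply]

@[simp]
theorem perm_X (σ : Equiv.Perm (Fin n)) (i : Fin n) : perm K σ (X i) = X (σ i) := by
  simp [perm_apply]

/-- The action of `S_n` by linear endomorphisms. -/
noncomputable def permEnd : Equiv.Perm (Fin n) →* Module.End ℂ (MvPolynomial (Fin n) K) where
  toFun σ := (perm K σ).toLinearMap
  map_one' := by rw [map_one]; rfl
  map_mul' σ τ := by rw [map_mul]; rfl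

@[simp]
theorem permEnd_apply (σ : Equiv.Perm (Fin n)) (p) : permEnd K σ p = perm K σ p := rfl

/-- Multiplication by a coordinate function. -/
noncomputable def position (i : Fin n) : Module.End ℂ (MvPolynomial (Fin n) K) :=
  LinearMap.mulLeft ℂ (C (coord K i))

omit [IsFractionRing (MvPolynomial (Fin n) ℂ) K] [IsScalarTower ℂ (MvPolynomial (Fin n) ℂ) K] in
@[simp]
theorem position_apply (i : Fin n) (p) : position K i p = C (coord K i) * p := rfl

/-- The classical Dunkl operators. -/
noncomputable def dunkl (i : Fin n) : Module.End ℂ (MvPolynomial (Fin n) K) :=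
  LinearMap.mulLeft ℂ (X i) + c • ∑ k ∈ Finset.univ.erase i,
    LinearMap.mulLeft ℂ (C (coord K i - coord K k)⁻¹) ∘ₗ permEnd K (Equiv.swap i k)

theorem dunkl_apply (i : Fin n) (p) : dunkl c K i p = X i * p + c • ∑ k ∈ Finset.univ.erase i,
    C (coord K i - coord K k)⁻¹ * perm K (Equiv.swap i k) p := by
  simp [dunkl]

theorem perm_mul_position (σ : Equiv.Perm (Fin n)) (i : Fin n) :
    permEnd K σ * position K i = position K (σ i) * permEnd K σ := by
  refine LinearMap.ext fun p => ?_
  simp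

theorem perm_mul_dunkl (σ : Equiv.Perm (Fin n)) (i : Fin n) :
    permEnd K σ * dunkl c K i = dunkl c K (σ i) * permEnd K σ := by
  refine LinearMap.ext fun p => ?_
  simp only [Module.End.mul_apply, permEnd_apply, dunkl_apply, map_add, map_mul, map_smul, map_sum,
    perm_C, perm_X, map_inv₀, map_sub, permField_coord]
  refine congrArg (X (σ i) * perm K σ p + ·) (congrArg (c • ·) ?_)
  refine Finset.sum_bij (fun k _ => σ k) (by simp) (fun _ _ _ _ h => σ.injective h)
    (fun k hk => ⟨σ.symm k, ?_, by simp⟩) fun k hk => ?_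
  · rw [Finset.mem_erase] at hk ⊢
    exact ⟨fun h => hk.1 (by simp [← h]), Finset.mem_univ _⟩
  · have : σ * Equiv.swap i k = Equiv.swap (σ i) (σ k) * σ := by
      rw [Equiv.mul_swap_eq_swap_mul]
    rw [← AlgHom.mul_apply, ← AlgHom.mul_apply, ← map_mul, ← map_mul, this]

theorem dunkl_position_ne (i j : Fin n) (h : i ≠ j) :
    dunkl c K i * position K j - position K j * dunkl c K i = c • permEnd K (Equiv.swap i j) := by
  refine LinearMap.ext fun p => ?_
  have hij : coord K i - coord K j ≠ 0 := sub_ne_zero.2 fun e => h (coord_injective K e)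
  simp only [LinearMap.sub_apply, Module.End.mul_apply, dunkl_apply, position_apply, map_mul,
    LinearMap.smul_apply, permEnd_apply, perm_C, permField_coord, mul_add, mul_smul_comm]
  rw [mul_left_comm, add_sub_add_left_eq_sub, ← smul_sub, Finset.mul_sum,
    ← Finset.sum_sub_distrib, Finset.sum_eq_single j]
  · rw [Equiv.swap_apply_right, mul_left_comm (C (coord K j)), ← mul_sub, ← sub_mul, ← C_sub,
      ← mul_assoc, ← C_mul, inv_mul_cancel₀ hij, C_1, one_mul]
  · intro k hk hkj
    rw [Equiv.swap_apply_of_ne_of_ne h.symm hkj.symm, mul_left_comm, sub_self]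
  · simp [h.symm]

theorem dunkl_position_eq (i : Fin n) :
    dunkl c K i * position K i - position K i * dunkl c K i =
      -(c • ∑ j ∈ Finset.univ.erase i, permEnd K (Equiv.swap i j)) := by
  refine LinearMap.ext fun p => ?_
  simp only [LinearMap.sub_apply, Module.End.mul_apply, dunkl_apply, position_apply, map_mul,
    LinearMap.smul_apply, permEnd_apply, perm_C, permField_coord, mul_add, mul_smul_comm,
    LinearMap.neg_apply, LinearMap.sum_apply, ← smul_neg, ← Finset.sum_neg_distrib]
  rw [mul_left_comm, add_sub_add_left_eq_sub, ← smul_sub, Finset.mul_sum,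
    ← Finset.sum_sub_distrib]
  refine congrArg (c • ·) (Finset.sum_congr rfl fun k hk => ?_)
  have hik : coord K i - coord K k ≠ 0 :=
    sub_ne_zero.2 fun e => (Finset.ne_of_mem_erase hk) (coord_injective K e).symm
  rw [Equiv.swap_apply_left, mul_left_comm (C (coord K i)), ← mul_sub, ← sub_mul, ← C_sub,
      ← mul_assoc, ← C_mul, ← neg_sub (coord K i), mul_neg, inv_mul_cancel₀ hik, C_neg, C_1, neg_one_mul]

/-- At t = 0 the momentum is a commuting symbol instead of a derivative, so only the transpositions
could obstruct, and they fix `q`. -/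
theorem dunkl_mul_of_invariant {q : MvPolynomial (Fin n) K} (hq : ∀ σ, perm K σ q = q) (i : Fin n)
    (p : MvPolynomial (Fin n) K) : dunkl c K i (q * p) = q * dunkl c K i p := by
  simp only [dunkl_apply, map_mul, hq, mul_add, mul_smul_comm, Finset.mul_sum]
  refine congrArg₂ (· + ·) (mul_left_comm _ _ _) (congrArg (c • ·) ?_)
  exact Finset.sum_congr rfl fun _ _ => mul_left_comm _ _ _

/-- The value of the Dunkl operator on `1`. -/
noncomputable def dunklOne (i : Fin n) : MvPolynomial (Fin n) K :=
  X i + c • ∑ k ∈ Finset.univ.erase i, C (coord K i - coord K k)⁻¹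

theorem dunkl_one (i : Fin n) : dunkl c K i 1 = dunklOne c K i := by
  simp [dunkl_apply, dunklOne]

theorem perm_dunklOne (σ : Equiv.Perm (Fin n)) (i : Fin n) :
    perm K σ (dunklOne c K i) = dunklOne c K (σ i) := by
  simpa [dunkl_one] using LinearMap.congr_fun (perm_mul_dunkl c K σ i) 1

/-- Among the transpositions s_{ik} only s_{ij} changes the j-th value. The result is symmetric in i
and j, so the commutator of two Dunkl operators kills 1. -/
theorem dunkl_dunklOne (i j : Fin n) (h : i ≠ j) : dunkl c K i (dunklOne c K j) =
    dunklOne c K i * dunklOne c K j +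
      c • (C (coord K i - coord K j)⁻¹ * (dunklOne c K i - dunklOne c K j)) := by
  have key : ∑ k ∈ Finset.univ.erase i, C (coord K i - coord K k)⁻¹ *
      perm K (Equiv.swap i k) (dunklOne c K j) =
      (∑ k ∈ Finset.univ.erase i, C (coord K i - coord K k)⁻¹) * dunklOne c K j +
      C (coord K i - coord K j)⁻¹ * (dunklOne c K i - dunklOne c K j) := by
    rw [← sub_eq_iff_eq_add', Finset.sum_mul, ← Finset.sum_sub_distrib, Finset.sum_eq_single j]
    · rw [perm_dunklOne, Equiv.swap_apply_right, mul_sub]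
    · intro k hk hkj
      rw [perm_dunklOne, Equiv.swap_apply_of_ne_of_ne h.symm hkj.symm, sub_self]
    · simp [h.symm]
  rw [dunkl_apply, key, smul_add, ← add_assoc]
  congr 1
  conv_rhs => rw [dunklOne]
  rw [add_mul, smul_mul_assoc]

/-- `D` is only assumed ℂ-linear. Commutation passes from coordinates to polynomials by induction,
and to fractions by clearing denominators in a domain. -/
theorem map_C_mul_of_commute_coord {D : Module.End ℂ (MvPolynomial (Fin n) K)}
    (hx : ∀ (k : Fin n) p, D (C (coord K k) * p) = C (coord K k) * D p) (r : K)
    (p : MvPolynomial (Fin n) K) : D (C r * p) = C r * D p := by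
  have hpoly : ∀ (a : MvPolynomial (Fin n) ℂ) p,
      D (C (algebraMap _ K a) * p) = C (algebraMap _ K a) * D p := by
    intro a
    induction a using MvPolynomial.induction_on with
    | C r =>
      intro p
      have : (C (algebraMap (MvPolynomial (Fin n) ℂ) K (C r)) : MvPolynomial (Fin n) K) =
          algebraMap ℂ _ r := by
        rw [IsScalarTower.algebraMap_apply ℂ K (MvPolynomial (Fin n) K),
          IsScalarTower.algebraMap_apply ℂ (MvPolynomial (Fin n) ℂ) K]
        rfl
      rw [this, ← Algebra.smul_def, map_smul, Algebra.smul_def]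
    | add a b ha hb => intro p; simp only [map_add, add_mul, ha, hb]
    | mul_X a k ha =>
      intro p
      rw [RingHom.map_mul, C_mul, mul_assoc, mul_assoc, ha]
      exact congrArg _ (hx k p)
  obtain ⟨a, b, hb, rfl⟩ := IsFractionRing.div_surjective (A := MvPolynomial (Fin n) ℂ) r
  have hb0 : algebraMap (MvPolynomial (Fin n) ℂ) K b ≠ 0 :=
    IsFractionRing.to_map_ne_zero_of_mem_nonZeroDivisors hb
  have hb1 : (C (algebraMap (MvPolynomial (Fin n) ℂ) K b) : MvPolynomial (Fin n) K) ≠ 0 := by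
    simpa using hb0
  refine mul_left_cancel₀ hb1 ?_
  rw [← hpoly, ← mul_assoc, ← C_mul, mul_div_cancel₀ _ hb0, ← mul_assoc, ← C_mul,
    mul_div_cancel₀ _ hb0, hpoly]

/-- The momenta are combinations, over the rational functions of the coordinates, of
`S_n`-invariant elements. -/
theorem exists_X_eq_sum_invariant (k : Fin n) : ∃ (r : Fin n → K)
    (q : Fin n → MvPolynomial (Fin n) K), (∀ i σ, perm K σ (q i) = q i) ∧
      X k = ∑ i, C (r i) * q i := by
  set V : Matrix (Fin n) (Fin n) K := (Matrix.vandermonde (coord K)).transpose with hV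
  have hdet : IsUnit V.det := by
    rw [hV, Matrix.det_transpose, isUnit_iff_ne_zero, Matrix.det_vandermonde_ne_zero_iff]
    exact coord_injective K
  -- The invariants are ∑_l x_l^i p_l for i < n. The passage from the p_l to them is a Vandermonde
  -- matrix in distinct coordinates, hence invertible.
  refine ⟨fun i => V⁻¹ k i, fun i => ∑ l, C (V i l) * X l, fun i σ => ?_, ?_⟩
  · simp only [hV, Matrix.transpose_apply, Matrix.vandermonde_apply, map_sum, map_mul, perm_C,
      perm_X, map_pow, permField_coord]
    exact Equiv.sum_comp σ (fun l => C (coord K l) ^ (i : ℕ) * X l)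
  · simp only [Finset.mul_sum]
    rw [Finset.sum_comm]
    have : ∀ l, ∑ r, C (V⁻¹ k r) * (C (V r l) * X l) =
        (C ((V⁻¹ * V) k l) * X l : MvPolynomial (Fin n) K) := by
      intro l
      rw [Matrix.mul_apply, map_sum, Finset.sum_mul]
      exact Finset.sum_congr rfl fun r _ => by rw [C_mul, mul_assoc]
    rw [Finset.sum_congr rfl fun l _ => this l, Matrix.nonsing_inv_mul V hdet,
      Finset.sum_eq_single k]
    · rw [Matrix.one_apply_eq, C_1, one_mul]
    · intro l _ hl
      rw [Matrix.one_apply_ne hl.symm, C_0, zero_mul]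
    · simp

/-- An operator commuting with the coordinates and with the invariants is a multiplication
operator. -/
theorem eq_mul_apply_one {D : Module.End ℂ (MvPolynomial (Fin n) K)}
    (hx : ∀ (k : Fin n) p, D (C (coord K k) * p) = C (coord K k) * D p)
    (hinv : ∀ q, (∀ σ, perm K σ q = q) → ∀ p, D (q * p) = q * D p)
    (p : MvPolynomial (Fin n) K) : D p = p * D 1 := by
  have hX : ∀ k p, D (X k * p) = X k * D p := by
    intro k p
    obtain ⟨r, q, hq, hk⟩ := exists_X_eq_sum_invariant K k
    rw [hk, Finset.sum_mul, Finset.sum_mul, map_sum]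
    exact Finset.sum_congr rfl fun i _ => by
      rw [mul_assoc, map_C_mul_of_commute_coord K hx, hinv _ (hq i), mul_assoc]
  induction p using MvPolynomial.induction_on with
  | C r => rw [← map_C_mul_of_commute_coord K hx r 1, mul_one]
  | add p q hp hq => rw [map_add, hp, hq, add_mul]
  | mul_X p k hp => rw [mul_comm p, hX, hp, mul_assoc]

/-- The commutator commutes with the coordinates, by the Jacobi identity, and with the invariants.
It is thus multiplication by its value at 1, which vanishes. -/
theorem dunkl_comm (i j : Fin n) : dunkl c K i * dunkl c K j = dunkl c K j * dunkl c K i := by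
  rcases eq_or_ne i j with rfl | hij
  · rfl
  rw [← sub_eq_zero]
  refine LinearMap.ext fun p => ?_
  rw [eq_mul_apply_one K (D := dunkl c K i * dunkl c K j - dunkl c K j * dunkl c K i)]
  · rw [LinearMap.sub_apply, Module.End.mul_apply, Module.End.mul_apply, dunkl_one, dunkl_one,
      dunkl_dunklOne c K i j hij, dunkl_dunklOne c K j i hij.symm,
      ← neg_sub (coord K i), inv_neg, C_neg, neg_mul, ← mul_neg, neg_sub,
      mul_comm (dunklOne c K j), sub_self, mul_zero, LinearMap.zero_apply]
  · intro k p
    have := IsCherednikTriple.commutator_y_mul_x (perm_mul_dunkl c K)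
      (dunkl_position_ne c K) (dunkl_position_eq c K) i j k
    exact LinearMap.congr_fun this p
  · intro q hq p
    simp only [LinearMap.sub_apply, Module.End.mul_apply, dunkl_mul_of_invariant c K hq, mul_sub]

/-- The Dunkl representation. -/
theorem isCherednikTriple :
    IsCherednikTriple c (permEnd (n := n) K) (position K) (dunkl c K) where
  gx := perm_mul_position K
  gy := perm_mul_dunkl c K
  xx i j := by exact LinearMap.ext fun p => mul_left_comm _ _ _
  yy := dunkl_comm c K
  yx_ne := dunkl_position_ne c K
  yx_eq := dunkl_position_eq c K

end Dunkl

/-! ### Leading terms in the momenta -/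

namespace Dunkl

open MvPolynomial

section LowDegree

variable {n : ℕ} (c : ℂ) (K : Type*) [Field K]

/-- The polynomials all of whose monomials have degree less than `d`. -/
def lowDegree (n d : ℕ) : Submodule K (MvPolynomial (Fin n) K) where
  carrier := {p | ∀ b : Fin n →₀ ℕ, d ≤ b.degree → coeff b p = 0}
  add_mem' hp hq b hb := by rw [coeff_add, hp b hb, hq b hb, add_zero]
  zero_mem' b _ := coeff_zero b
  smul_mem' r p hp b hb := by rw [coeff_smul, hp b hb, smul_zero]

theorem lowDegree_mono {d d' : ℕ} (h : d ≤ d') : lowDegree K n d ≤ lowDegree K n d' :=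
  fun _ hp b hb => hp b (h.trans hb)

theorem C_mul_mem_lowDegree {d : ℕ} {p : MvPolynomial (Fin n) K} (hp : p ∈ lowDegree K n d) (r : K) :
    C r * p ∈ lowDegree K n d := by
  rw [← smul_eq_C_mul]
  exact Submodule.smul_mem _ r hp

theorem X_mul_mem_lowDegree {d : ℕ} {p : MvPolynomial (Fin n) K} (hp : p ∈ lowDegree K n d)
    (i : Fin n) : X i * p ∈ lowDegree K n (d + 1) := by
  intro b hb
  rw [coeff_X_mul']
  split_ifs with h
  · refine hp _ ?_
    have hle : Finsupp.single i 1 ≤ b := by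
      rw [Finsupp.single_le_iff]
      exact Nat.one_le_iff_ne_zero.2 (Finsupp.mem_support_iff.1 h)
    have := congrArg Finsupp.degree (tsub_add_cancel_of_le hle)
    rw [map_add, Finsupp.degree_single] at this
    omega
  · rfl

variable [Algebra ℂ K] [Algebra (MvPolynomial (Fin n) ℂ) K]
  [IsFractionRing (MvPolynomial (Fin n) ℂ) K] [IsScalarTower ℂ (MvPolynomial (Fin n) ℂ) K]

theorem perm_mem_lowDegree {d : ℕ} {p : MvPolynomial (Fin n) K} (hp : p ∈ lowDegree K n d)
    (σ : Equiv.Perm (Fin n)) : perm K σ p ∈ lowDegree K n d := by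
  intro b hb
  have hb' : b = Finsupp.mapDomain σ (Finsupp.mapDomain σ.symm b) := by
    rw [← Finsupp.mapDomain_comp]; simp
  rw [hb', perm_apply, coeff_rename_mapDomain _ σ.injective, coeff_map, hp, map_zero]
  rwa [Finsupp.degree_mapDomain]

theorem dunkl_sub_mem_lowDegree {d : ℕ} {p : MvPolynomial (Fin n) K} (hp : p ∈ lowDegree K n d)
    (i : Fin n) : dunkl c K i p - X i * p ∈ lowDegree K n d := by
  rw [dunkl_apply, add_sub_cancel_left, ← algebraMap_smul K c]
  exact Submodule.smul_mem _ _ (sum_mem fun k _ =>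
    C_mul_mem_lowDegree K (perm_mem_lowDegree K hp _) _)

/-- Each Dunkl operator is multiplication by its momentum up to terms that do not raise the degree,
so a product of them applied to 1 has the corresponding monomial as leading term. -/
theorem commAeval_dunkl_sub_mem_lowDegree (b : Fin n →₀ ℕ) :
    commAeval (dunkl c K) (dunkl_comm c K) (monomial b 1) 1 - monomial b 1 ∈
      lowDegree K n b.degree := by
  induction hd : b.degree generalizing b with
  | zero =>
    rw [Finsupp.degree_eq_zero_iff] at hd
    subst hd
    rw [← C_apply, ← C_apply, commAeval_C, RingHom.map_one, C_1, Module.End.one_apply, sub_self]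
    exact zero_mem _
  | succ d ih =>
    obtain ⟨i, hi⟩ : ∃ i, b i ≠ 0 := by
      by_contra! h
      have : b = 0 := Finsupp.ext h
      simp [this] at hd
    obtain ⟨a, rfl⟩ : ∃ a, b = Finsupp.single i 1 + a :=
      exists_add_of_le (Finsupp.single_le_iff.2 (Nat.one_le_iff_ne_zero.2 hi))
    have ha : a.degree = d := by
      rw [map_add, Finsupp.degree_single] at hd
      omega
    rw [monomial_single_add, monomial_single_add, pow_one, pow_one, map_mul, commAeval_X, Module.End.mul_apply]
    set F := commAeval (dunkl c K) (dunkl_comm c K) (monomial a 1) 1 with hF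
    have h1 := ih a ha
    have hmon : (monomial a 1 : MvPolynomial (Fin n) K) ∈ lowDegree K n (d + 1) := by
      intro b hb
      rw [coeff_monomial, if_neg]
      rintro rfl
      omega
    have h2 : F ∈ lowDegree K n (d + 1) := by
      have := add_mem (lowDegree_mono K d.le_succ h1) hmon
      rwa [sub_add_cancel] at this
    have := add_mem (dunkl_sub_mem_lowDegree c K h2 i) (X_mul_mem_lowDegree K h1 i)
    rwa [mul_sub, sub_add_sub_cancel] at this

theorem coeff_commAeval_dunkl {b b' : Fin n →₀ ℕ} (h : b'.degree ≤ b.degree) :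
    coeff b (commAeval (dunkl c K) (dunkl_comm c K) (monomial b' 1) 1) = if b' = b then 1 else 0 := by
  have := commAeval_dunkl_sub_mem_lowDegree c K b' b h
  rwa [coeff_sub, coeff_monomial, sub_eq_zero] at this

theorem commAeval_position (f : MvPolynomial (Fin n) ℂ) (p : MvPolynomial (Fin n) K) :
    commAeval (position K) (isCherednikTriple c K).xx f p = C (algebraMap _ K f) * p := by
  induction f using MvPolynomial.induction_on generalizing p with
  | C r =>
    have : (C (algebraMap (MvPolynomial (Fin n) ℂ) K (C r)) : MvPolynomial (Fin n) K) =
        algebraMap ℂ _ r := by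
      rw [IsScalarTower.algebraMap_apply ℂ K (MvPolynomial (Fin n) K),
        IsScalarTower.algebraMap_apply ℂ (MvPolynomial (Fin n) ℂ) K]
      rfl
    rw [this, commAeval_C, Module.algebraMap_end_apply, Algebra.smul_def]
  | add f g hf hg => rw [map_add, LinearMap.add_apply, hf, hg, map_add, C_add, add_mul]
  | mul_X f i hf =>
    rw [map_mul, Module.End.mul_apply, commAeval_X, position_apply, hf, map_mul, C_mul, mul_assoc]
    rfl

end LowDegree

end Dunkl

/-! ### Faithfulness on He and commutativity of eHe -/

namespace RationalCherednikAlgebra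

open MvPolynomial

variable {n : ℕ} {c : ℂ}

/-- The symmetrizer of `S_n` in `H_{t,c}`. -/
noncomputable def symmetrizer (n : ℕ) (t c : ℂ) : RationalCherednikAlgebra n t c :=
  (n.factorial : ℂ)⁻¹ • ∑ σ, ofPerm n t c σ

theorem ofPerm_mul_symmetrizer {t : ℂ} (σ : Equiv.Perm (Fin n)) :
    ofPerm n t c σ * symmetrizer n t c = symmetrizer n t c := by
  rw [symmetrizer, mul_smul_comm, Finset.mul_sum]
  congr 1
  simp only [← map_mul]
  exact Equiv.sum_comp (Equiv.mulLeft σ) (fun τ => ofPerm n t c τ)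

/-- Combinations of the ordered products (polynomial in `x`)·(monomial in `y`)·(symmetrizer). -/
noncomputable def orderedCombination (n : ℕ) (c : ℂ) :
    ((Fin n →₀ ℕ) →₀ MvPolynomial (Fin n) ℂ) →ₗ[ℂ] RationalCherednikAlgebra n 0 c :=
  Finsupp.lsum ℂ fun b =>
    LinearMap.mulRight ℂ (commAeval (y n 0 c) (isCherednikTriple n c).yy (monomial b 1) *
      symmetrizer n 0 c) ∘ₗ (commAeval (x n 0 c) (isCherednikTriple n c).xx).toLinearMap

theorem orderedCombination_apply (q : (Fin n →₀ ℕ) →₀ MvPolynomial (Fin n) ℂ) :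
    orderedCombination n c q = ∑ b ∈ q.support,
      commAeval (x n 0 c) (isCherednikTriple n c).xx (q b) *
      (commAeval (y n 0 c) (isCherednikTriple n c).yy (monomial b 1) * symmetrizer n 0 c) := by
  simp [orderedCombination, Finsupp.sum, mul_assoc]

theorem exists_orderedCombination (a : RationalCherednikAlgebra n 0 c) :
    ∃ q, orderedCombination n c q = a * symmetrizer n 0 c := by
  have hV : ∀ σ, ∀ v ∈ Submodule.span ℂ {symmetrizer n 0 c}, ofPerm n 0 c σ * v ∈
      Submodule.span ℂ {symmetrizer n 0 c} := by
    intro σ v hv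
    obtain ⟨r, rfl⟩ := Submodule.mem_span_singleton.1 hv
    rwa [mul_smul_comm, ofPerm_mul_symmetrizer]
  have he : symmetrizer n 0 c ∈ (isCherednikTriple n c).orderedSpan
      (Submodule.span ℂ {symmetrizer n 0 c}) := by
    simpa using (isCherednikTriple n c).mem_orderedSpan
      (Submodule.mem_span_singleton_self (symmetrizer n 0 c)) 1 1
  suffices h : (isCherednikTriple n c).orderedSpan (Submodule.span ℂ {symmetrizer n 0 c}) ≤
      LinearMap.range (orderedCombination n c) from h (mul_mem_orderedSpan hV a he)
  refine Submodule.span_le.2 ?_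
  rintro _ ⟨f, h, v, hv, rfl⟩
  obtain ⟨r, rfl⟩ := Submodule.mem_span_singleton.1 hv
  rw [mul_smul_comm]
  refine Submodule.smul_mem _ _ ?_
  induction h using MvPolynomial.induction_on' with
  | monomial b s =>
    refine ⟨Finsupp.single b (s • f), ?_⟩
    have : (monomial b s : MvPolynomial (Fin n) ℂ) = s • monomial b 1 := by
      rw [smul_monomial, smul_eq_mul, mul_one]
    simp [orderedCombination, this, mul_assoc]
  | add h h' hh hh' =>
    rw [map_add, mul_add, add_mul]
    exact add_mem hh hh'

section Dunkl

variable (n c)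

/-- The field of rational functions in the coordinates. -/
abbrev CoordField (n : ℕ) : Type := FractionRing (MvPolynomial (Fin n) ℂ)

/-- The Dunkl representation of `H_{0,c}`. -/
noncomputable def dunklRep : RationalCherednikAlgebra n 0 c →ₐ[ℂ]
    Module.End ℂ (MvPolynomial (Fin n) (CoordField n)) :=
  lift (Dunkl.isCherednikTriple c (CoordField n))

variable {n c}

theorem dunklRep_symmetrizer_of_invariant {p : MvPolynomial (Fin n) (CoordField n)}
    (hp : ∀ σ, Dunkl.perm (CoordField n) σ p = p) : dunklRep n c (symmetrizer n 0 c) p = p := by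
  simp only [dunklRep, symmetrizer, map_smul, map_sum, lift_ofPerm, LinearMap.smul_apply,
    LinearMap.sum_apply, Dunkl.permEnd_apply, hp]
  rw [Finset.sum_const, Finset.card_univ, Fintype.card_perm, Fintype.card_fin,
    ← Nat.cast_smul_eq_nsmul ℂ, smul_smul, inv_mul_cancel₀, one_smul]
  exact_mod_cast n.factorial_ne_zero

theorem perm_dunklRep_symmetrizer (σ) (p : MvPolynomial (Fin n) (CoordField n)) :
    Dunkl.perm (CoordField n) σ (dunklRep n c (symmetrizer n 0 c) p) =
      dunklRep n c (symmetrizer n 0 c) p := by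
  have := congrArg (fun a => dunklRep n c a p) (ofPerm_mul_symmetrizer (c := c) (t := 0) σ)
  simpa [dunklRep] using this

theorem dunklRep_mul_of_invariant {q : MvPolynomial (Fin n) (CoordField n)}
    (hq : ∀ σ, Dunkl.perm (CoordField n) σ q = q) (a : RationalCherednikAlgebra n 0 c)
    (p : MvPolynomial (Fin n) (CoordField n)) :
    dunklRep n c a (q * p) = q * dunklRep n c a p := by
  induction a using induction generalizing p with
  | algebraMap r => simp
  | ofPerm σ => simp [dunklRep, hq]
  | x i => simpa [dunklRep] using mul_left_comm _ _ _
  | y i => simpa [dunklRep] using Dunkl.dunkl_mul_of_invariant c (CoordField n) hq i p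
  | add a b ha hb => simp [ha, hb, mul_add]
  | mul a b ha hb => simp [ha, hb]

theorem dunklRep_orderedCombination (q : (Fin n →₀ ℕ) →₀ MvPolynomial (Fin n) ℂ) :
    dunklRep n c (orderedCombination n c q) 1 = ∑ b ∈ q.support,
      C (algebraMap _ (CoordField n) (q b)) * commAeval (Dunkl.dunkl c (CoordField n))
        (Dunkl.dunkl_comm c (CoordField n)) (monomial b 1) 1 := by
  rw [orderedCombination_apply, map_sum, LinearMap.sum_apply]
  refine Finset.sum_congr rfl fun b _ => ?_
  rw [map_mul, map_mul, Module.End.mul_apply, Module.End.mul_apply,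
    dunklRep_symmetrizer_of_invariant (fun σ => map_one _)]
  have hx := map_commAeval (B := Module.End ℂ (MvPolynomial (Fin n) (CoordField n))) (x n 0 c) (isCherednikTriple n c).xx (dunklRep n c) (q b)
  have hy := map_commAeval (B := Module.End ℂ (MvPolynomial (Fin n) (CoordField n))) (y n 0 c) (isCherednikTriple n c).yy (dunklRep n c) (monomial b 1)
  simp only [dunklRep, lift_x, lift_y] at hx hy
  rw [dunklRep, hx, hy]
  exact Dunkl.commAeval_position c (CoordField n) _ _

/-- The Dunkl representation is faithful on `H_{0,c} e`, and already the vector `1` detects this. -/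
theorem mul_symmetrizer_eq_zero {a : RationalCherednikAlgebra n 0 c}
    (ha : dunklRep n c (a * symmetrizer n 0 c) 1 = 0) : a * symmetrizer n 0 c = 0 := by
  obtain ⟨q, hq⟩ := exists_orderedCombination a
  rw [← hq] at ha ⊢
  suffices q = 0 by rw [this, map_zero]
  by_contra hne
  -- At a `b` of maximal degree no other summand contributes to the coefficient of p^b, which is
  -- therefore the rational function `q b`.
  obtain ⟨b, hb, hmax⟩ := q.support.exists_max_image Finsupp.degree
    (Finsupp.support_nonempty_iff.2 hne)
  have h0 := congrArg (coeff b) ha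
  rw [dunklRep_orderedCombination, coeff_sum, Finset.sum_eq_single b, coeff_C_mul,
    Dunkl.coeff_commAeval_dunkl c _ le_rfl, if_pos rfl, mul_one, coeff_zero] at h0
  · rw [map_eq_zero_iff _ (IsFractionRing.injective _ _)] at h0
    exact Finsupp.mem_support_iff.1 hb h0
  · intro b' hb' hne'
    rw [coeff_C_mul, Dunkl.coeff_commAeval_dunkl c _ (hmax b' hb'), if_neg hne', mul_zero]
  · exact fun h => absurd hb h

/-- The spherical subalgebra of `H_{0,c}` is commutative. -/
theorem spherical_comm (a b : RationalCherednikAlgebra n 0 c) :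
    symmetrizer n 0 c * a * symmetrizer n 0 c * b * symmetrizer n 0 c =
      symmetrizer n 0 c * b * symmetrizer n 0 c * a * symmetrizer n 0 c := by
  have key : ∀ a b : RationalCherednikAlgebra n 0 c, dunklRep n c
      (symmetrizer n 0 c * a * symmetrizer n 0 c * b * symmetrizer n 0 c) 1 =
      dunklRep n c (symmetrizer n 0 c * b) 1 * dunklRep n c (symmetrizer n 0 c * a) 1 := by
    intro a b
    have hinv : ∀ σ, Dunkl.perm (CoordField n) σ (dunklRep n c (symmetrizer n 0 c * b) 1) =
        dunklRep n c (symmetrizer n 0 c * b) 1 := by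
      intro σ
      rw [map_mul, Module.End.mul_apply, perm_dunklRep_symmetrizer]
    -- Since e fixes 1, the factor eb applied to 1 gives an invariant; e fixes it again, and it is
    -- pulled out of the action of ea.
    rw [← dunklRep_mul_of_invariant hinv, mul_one, mul_assoc _ _ b, map_mul _ (_ * _),
      Module.End.mul_apply, dunklRep_symmetrizer_of_invariant (fun σ => map_one _), map_mul _ _ (_ * b),
      Module.End.mul_apply]
  rw [← sub_eq_zero, ← sub_mul]
  refine mul_symmetrizer_eq_zero ?_
  rw [sub_mul, map_sub, LinearMap.sub_apply, key, key, mul_comm, sub_self]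

end Dunkl

end RationalCherednikAlgebra

/-! ### Central elements act by scalars -/

section Schur

variable {A : Type*} [Ring A] [Algebra ℂ A] {E : Type*} [AddCommGroup E] [Module ℂ E]
  [Module A E] [IsScalarTower ℂ A E] [IsSimpleModule A E]

/-- Dixmier's version of Schur's lemma: a central element of a `ℂ`-algebra of countable dimension
acts on every simple module by a scalar. -/
theorem IsSimpleModule.exists_scalar_of_central (hA : Module.rank ℂ A ≤ Cardinal.aleph0) {z : A}
    (hz : ∀ a, z * a = a * z) : ∃ r : ℂ, ∀ v : E, z • v = r • v := by
  classical
  have : Nontrivial E := IsSimpleModule.nontrivial A E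
  obtain ⟨v₀, hv₀⟩ := exists_ne (0 : E)
  let D := Module.End A E
  -- The centre of the division ring End_A(E) is a field containing the action of z. If z were
  -- transcendental, the uncountably many (z - r)⁻¹ would be independent in it, and evaluation at
  -- `v₀` would embed them in a space of countable dimension.
  let F := Subring.center D
  let i : ℂ →+* F :=
    { toFun := fun r => ⟨algebraMap ℂ D r, Subring.mem_center_iff.2 fun d =>
        (Algebra.commutes r d).symm⟩
      map_one' := by ext1; simp
      map_mul' := fun a b => by ext1; simp
      map_zero' := by ext1; simp
      map_add' := fun a b => by ext1; simp }
  let : Algebra ℂ F := i.toAlgebra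
  have hi : ∀ (r : ℂ) (v : E), ((algebraMap ℂ F r : F) : D) v = r • v := fun r v => rfl
  let zD : D :=
    { toFun := fun v => z • v
      map_add' := smul_add z
      map_smul' := fun a v => by simp [smul_smul, hz] }
  let d : F := ⟨zD, Subring.mem_center_iff.2 fun f => LinearMap.ext fun v => by
    change f (z • v) = z • f v
    exact map_smul f z v⟩
  by_cases hd : IsIntegral ℂ d
  · obtain ⟨r, hr⟩ := minpoly.mem_range_of_degree_eq_one ℂ d
      (IsAlgClosed.degree_eq_one_of_irreducible ℂ (minpoly.irreducible hd))
    refine ⟨r, fun v => ?_⟩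
    rw [← hi, hr]
    rfl
  · have htr : Transcendental ℂ d := fun h => hd (isAlgebraic_iff_isIntegral.1 h)
    have hli := htr.linearIndependent_sub_inv
    let ev : F →ₗ[ℂ] E :=
      { toFun := fun f => (f : D) v₀
        map_add' := fun _ _ => rfl
        map_smul' := fun r f => by
          rw [Algebra.smul_def]
          exact hi r _ }
    have hev : LinearMap.ker ev = ⊥ := by
      rw [LinearMap.ker_eq_bot']
      intro f hf
      by_contra hne
      have hne' : (f : D) ≠ 0 := fun h => hne (Subtype.ext h)
      exact hv₀ (((LinearMap.bijective_of_ne_zero hne').1) (hf.trans (map_zero _).symm))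
    let q : A →ₗ[ℂ] E := (LinearMap.toSpanSingleton A E v₀).restrictScalars ℂ
    have hsurj : Function.Surjective q := IsSimpleModule.toSpanSingleton_surjective A hv₀
    choose a ha using fun r : ℂ => hsurj (ev (d - algebraMap ℂ F r)⁻¹)
    have hla : LinearIndependent ℂ a := by
      refine LinearIndependent.of_comp q ?_
      have hcomp : q ∘ a = ev ∘ fun r => (d - algebraMap ℂ F r)⁻¹ := funext ha
      rw [hcomp]
      exact hli.map' ev hev
    have hcard := hla.cardinal_lift_le_rank
    rw [Cardinal.lift_uzero, Cardinal.mk_complex, Cardinal.lift_continuum] at hcard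
    exact absurd (hcard.trans hA) (not_le.2 Cardinal.aleph0_lt_continuum)

end Schur

/-! ### Finite dimensionality of simple modules -/

/-- Polynomials in finitely many commuting elements that are algebraic over `ℂ` form a finite
dimensional space. -/
theorem commAeval_range_fg {A : Type*} [Ring A] [Algebra ℂ A] {ι : Type*} [Finite ι] (x : ι → A)
    (hx : ∀ i j, x i * x j = x j * x i) (hint : ∀ i, IsIntegral ℂ (x i)) :
    (LinearMap.range (commAeval x hx).toLinearMap).FG := by
  let I := RingHom.ker (commAeval x hx)
  let Q := MvPolynomial ι ℂ ⧸ I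
  let ψ : Q →ₐ[ℂ] A := Ideal.Quotient.liftₐ I (commAeval x hx) fun a ha => ha
  have hψ : Function.Injective ψ := by
    rw [injective_iff_map_eq_zero]
    intro a ha
    obtain ⟨a, rfl⟩ := Ideal.Quotient.mk_surjective a
    exact Ideal.Quotient.eq_zero_iff_mem.2 ha
  have hQ : (⊤ : Subalgebra ℂ Q) =
      Algebra.adjoin ℂ (Set.range fun i => Ideal.Quotient.mkₐ ℂ I (MvPolynomial.X i)) := by
    rw [← (AlgHom.range_eq_top _).2 (Ideal.Quotient.mkₐ_surjective ℂ I), ← Algebra.map_top,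
      ← MvPolynomial.adjoin_range_X, AlgHom.map_adjoin, ← Set.range_comp]
    rfl
  have hfin : (Subalgebra.toSubmodule (⊤ : Subalgebra ℂ Q)).FG := by
    rw [hQ]
    refine fg_adjoin_of_finite (Set.finite_range _) ?_
    rintro _ ⟨i, rfl⟩
    refine (isIntegral_algHom_iff ψ hψ).1 ?_
    convert hint i
    exact commAeval_X x hx i
  have := hfin.map ψ.toLinearMap
  convert this using 1
  ext a
  constructor
  · rintro ⟨f, rfl⟩
    exact ⟨Ideal.Quotient.mk I f, trivial, rfl⟩
  · rintro ⟨q, -, rfl⟩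
    obtain ⟨f, rfl⟩ := Ideal.Quotient.mk_surjective q
    exact ⟨f, rfl⟩

open MvPolynomial in
/-- If the symmetric polynomials in commuting elements are scalars, these elements are algebraic. -/
theorem isIntegral_of_isSymmetric_scalar {A : Type*} [Ring A] [Nontrivial A] [Algebra ℂ A]
    {ι : Type*} [Fintype ι] (x : ι → A) (hx : ∀ i j, x i * x j = x j * x i)
    (h : ∀ f : MvPolynomial ι ℂ, f.IsSymmetric → ∃ r, commAeval x hx f = algebraMap ℂ A r) (i : ι) :
    IsIntegral ℂ (x i) := by
  classical
  -- Each X_i is a root of this monic polynomial with symmetric coefficients; replacing these by the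
  -- scalars they become gives an equation over ℂ.
  let P : Polynomial (MvPolynomial ι ℂ) := ∏ j, (Polynomial.X - Polynomial.C (X j))
  have hP : P.Monic := Polynomial.monic_prod_of_monic _ _ fun j _ => Polynomial.monic_X_sub_C _
  have hsymm : ∀ k, (P.coeff k).IsSymmetric := by
    intro k σ
    have : P.map (rename σ : MvPolynomial ι ℂ →ₐ[ℂ] MvPolynomial ι ℂ).toRingHom = P := by
      simp only [P, Polynomial.map_prod, Polynomial.map_sub, Polynomial.map_X, Polynomial.map_C]
      simp only [AlgHom.toRingHom_eq_coe, RingHom.coe_coe, rename_X]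
      exact Equiv.prod_comp σ fun j => Polynomial.X - Polynomial.C (X j : MvPolynomial ι ℂ)
    conv_rhs => rw [← this]
    rw [Polynomial.coeff_map]
    rfl
  choose r hr using fun k => h (P.coeff k) (hsymm k)
  have hlead : r P.natDegree = 1 := by
    have := hr P.natDegree
    rw [hP.coeff_natDegree, map_one] at this
    exact ((algebraMap ℂ A).injective (by rw [map_one, this])).symm
  have heval : P.eval (X i) = 0 := by
    simp only [P, Polynomial.eval_prod]
    exact Finset.prod_eq_zero (Finset.mem_univ i) (by simp)
  rw [Polynomial.eval_eq_sum_range] at heval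
  have heval' := congrArg (commAeval x hx) heval
  simp only [map_sum, map_mul, map_pow, hr, commAeval_X, map_zero] at heval'
  rw [← isAlgebraic_iff_isIntegral]
  refine ⟨∑ k ∈ Finset.range (P.natDegree + 1), Polynomial.monomial k (r k), fun h0 => ?_, ?_⟩
  · have := congrArg (Polynomial.coeff · P.natDegree) h0
    simp only [Polynomial.finsetSum_coeff, Polynomial.coeff_monomial] at this
    simp [hlead] at this
  · rw [map_sum, ← heval']
    exact Finset.sum_congr rfl fun k _ => by rw [Polynomial.aeval_monomial]

namespace RationalCherednikAlgebra

variable {n : ℕ} {t c : ℂ}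

/-- Words in the finitely many generators span. This is the countability needed for Schur's lemma
without assuming finite dimension. -/
theorem rank_le_aleph0 : Module.rank ℂ (RationalCherednikAlgebra n t c) ≤ Cardinal.aleph0 := by
  have : Countable (CherednikGen n) := by
    let f : CherednikGen n → Equiv.Perm (Fin n) ⊕ Fin n ⊕ Fin n
      | .g σ => .inl σ
      | .x i => .inr (.inl i)
      | .y i => .inr (.inr i)
    refine Function.Injective.countable (f := f) ?_
    rintro (a | a | a) (b | b | b) h <;> simp_all [f]
  refine (LinearMap.rank_le_of_surjective
    (RingQuot.mkAlgHom ℂ (CherednikRel n t c)).toLinearMap (RingQuot.mkAlgHom_surjective ℂ _)).trans ?_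
  rw [FreeAlgebra.rank_eq, Cardinal.lift_le_aleph0]
  exact Cardinal.mk_le_aleph0

variable {E : Type*} [AddCommGroup E] [Module ℂ E] [Module (RationalCherednikAlgebra n 0 c) E]
    [IsScalarTower ℂ (RationalCherednikAlgebra n 0 c) E]

/-- The action of `H_{0,c}` on a module, by linear endomorphisms. -/
noncomputable def toEnd (c : ℂ) (E : Type*) [AddCommGroup E] [Module ℂ E]
    [Module (RationalCherednikAlgebra n 0 c) E]
    [IsScalarTower ℂ (RationalCherednikAlgebra n 0 c) E] :
    RationalCherednikAlgebra n 0 c →ₐ[ℂ] Module.End ℂ E := Algebra.lsmul ℂ ℂ E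

theorem commute_of_generators {z : RationalCherednikAlgebra n t c}
    (hg : ∀ σ, ofPerm n t c σ * z = z * ofPerm n t c σ) (hx : ∀ i, x n t c i * z = z * x n t c i)
    (hy : ∀ i, y n t c i * z = z * y n t c i) (a) : z * a = a * z := by
  induction a using induction with
  | algebraMap r => exact (Algebra.commutes r z).symm
  | ofPerm σ => exact (hg σ).symm
  | x i => exact (hx i).symm
  | y i => exact (hy i).symm
  | add a b ha hb => rw [mul_add, add_mul, ha, hb]
  | mul a b ha hb => rw [← mul_assoc, ha, mul_assoc, hb, mul_assoc]

theorem finite_of_isSimpleModule [IsSimpleModule (RationalCherednikAlgebra n 0 c) E] :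
    Module.Finite ℂ E := by
  have : Nontrivial E := IsSimpleModule.nontrivial (RationalCherednikAlgebra n 0 c) E
  obtain ⟨v₀, hv₀⟩ := exists_ne (0 : E)
  have T := isCherednikTriple n c
  have T' := T.map (toEnd c E)
  have hx : ∀ i, IsIntegral ℂ (toEnd c E (x n 0 c i)) := by
    refine isIntegral_of_isSymmetric_scalar _ T'.xx fun f hf => ?_
    obtain ⟨r, hr⟩ := IsSimpleModule.exists_scalar_of_central (E := E) rank_le_aleph0
      (commute_of_generators (z := commAeval (x n 0 c) T.xx f) (T.g_commute_of_isSymmetric hf)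
        (fun i => commAeval_commute _ _ (T.xx i) f) (T.y_commute_of_isSymmetric hf))
    exact ⟨r, (map_commAeval _ T.xx (toEnd c E) f).symm.trans (LinearMap.ext hr)⟩
  have hy : ∀ i, IsIntegral ℂ (toEnd c E (y n 0 c i)) := by
    refine isIntegral_of_isSymmetric_scalar _ T'.yy fun f hf => ?_
    obtain ⟨r, hr⟩ := IsSimpleModule.exists_scalar_of_central (E := E) rank_le_aleph0
      (commute_of_generators (z := commAeval (y n 0 c) T.yy f)
        (T.exchange.g_commute_of_isSymmetric hf) (T.exchange.y_commute_of_isSymmetric hf)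
        (fun i => commAeval_commute _ _ (T.yy i) f))
    exact ⟨r, (map_commAeval _ T.yy (toEnd c E) f).symm.trans (LinearMap.ext hr)⟩
  let V : Submodule ℂ (RationalCherednikAlgebra n 0 c) :=
    Submodule.span ℂ (Set.range (ofPerm n 0 c))
  have hV : ∀ σ, ∀ v ∈ V, ofPerm n 0 c σ * v ∈ V := by
    intro σ
    suffices V ≤ V.comap (LinearMap.mulLeft ℂ (ofPerm n 0 c σ)) from fun v hv => this hv
    refine Submodule.span_le.2 ?_
    rintro _ ⟨τ, rfl⟩
    exact Submodule.subset_span ⟨σ * τ, map_mul _ _ _⟩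
  have h1 : (1 : RationalCherednikAlgebra n 0 c) ∈ T.orderedSpan V := by
    simpa using T.mem_orderedSpan (V := V) (Submodule.subset_span ⟨1, map_one _⟩) 1 1
  let N := LinearMap.range (commAeval _ T'.xx).toLinearMap *
    LinearMap.range (commAeval _ T'.yy).toLinearMap * V.map (toEnd c E).toLinearMap
  have hN : N.FG := ((commAeval_range_fg _ T'.xx hx).mul (commAeval_range_fg _ T'.yy hy)).mul
    ((Submodule.fg_span (Set.finite_range _)).map _)
  have hle : T.orderedSpan V ≤ N.comap (toEnd c E).toLinearMap := by
    refine Submodule.span_le.2 ?_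
    rintro _ ⟨f, h, v, hv, rfl⟩
    change toEnd c E _ ∈ N
    rw [map_mul, map_mul]
    refine Submodule.mul_mem_mul (Submodule.mul_mem_mul ⟨f, ?_⟩ ⟨h, ?_⟩) ⟨v, hv, rfl⟩
    · exact (map_commAeval _ T.xx (toEnd c E) f).symm
    · exact (map_commAeval _ T.yy (toEnd c E) h).symm
  refine ⟨?_⟩
  -- `N` is finite dimensional and contains the image of the whole algebra, so evaluating it at `v₀`
  -- fills the simple module.
  have htop : N.map (LinearMap.applyₗ v₀ : Module.End ℂ E →ₗ[ℂ] E) = ⊤ := by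
    rw [eq_top_iff]
    rintro v -
    obtain ⟨a, rfl⟩ :=
      IsSimpleModule.toSpanSingleton_surjective (RationalCherednikAlgebra n 0 c) hv₀ v
    refine ⟨toEnd c E a, hle ?_, rfl⟩
    simpa using mul_mem_orderedSpan hV a h1
  rw [← htop]
  exact hN.map _

end RationalCherednikAlgebra

/-! ### Recognising the regular representation -/

section HomDimension

open Module

variable {k R : Type*} [Field k] [Ring R] [Algebra k R]

theorem finrank_hom_of_equiv_prod {E A B T : Type*}
    [AddCommGroup E] [Module R E]
    [AddCommGroup A] [Module k A] [Module R A] [IsScalarTower k R A] [Module.Finite k A]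
    [AddCommGroup B] [Module k B] [Module R B] [IsScalarTower k R B] [Module.Finite k B]
    [AddCommGroup T] [Module k T] [Module R T] [IsScalarTower k R T] [Module.Finite k T]
    (e : E ≃ₗ[R] A × B) :
    finrank k (E →ₗ[R] T) = finrank k (A →ₗ[R] T) + finrank k (B →ₗ[R] T) := by
  have : Module.Finite k (A →ₗ[R] T) := .of_injective (LinearMap.restrictScalarsₗ k R A T k)
    (LinearMap.restrictScalars_injective _)
  have : Module.Finite k (B →ₗ[R] T) := .of_injective (LinearMap.restrictScalarsₗ k R B T k)
    (LinearMap.restrictScalars_injective _)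
  rw [(e.congrLeft T k).finrank_eq, ← (LinearMap.coprodEquiv k (R := R)).finrank_eq,
    finrank_prod]

/-- Finite-dimensional semisimple modules of the same dimension with the same dimensions of spaces
of homomorphisms to all finite-dimensional modules are isomorphic. -/
theorem nonempty_linearEquiv_of_finrank_hom_eq.{u, v} (d : ℕ) : ∀ (E : Type u) (F : Type v)
    [AddCommGroup E] [Module k E] [Module R E] [IsScalarTower k R E] [Module.Finite k E]
    [IsSemisimpleModule R E]
    [AddCommGroup F] [Module k F] [Module R F] [IsScalarTower k R F] [Module.Finite k F]
    [IsSemisimpleModule R F], finrank k E = d → finrank k F = d →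
    (∀ (T : Type u) [AddCommGroup T] [Module k T] [Module R T] [IsScalarTower k R T]
      [Module.Finite k T], finrank k (E →ₗ[R] T) = finrank k (F →ₗ[R] T)) →
    Nonempty (E ≃ₗ[R] F) := by
  induction d using Nat.strong_induction_on with
  | _ d ih =>
  intro E F _ _ _ _ _ _ _ _ _ _ _ _ hE hF hT
  rcases subsingleton_or_nontrivial E with hs | hn
  · have hd : d = 0 := by rw [← hE]; exact finrank_zero_of_subsingleton
    have : Subsingleton F := finrank_zero_iff.1 (hF.trans hd)
    exact ⟨0⟩
  obtain ⟨S, hS⟩ := IsSemisimpleModule.exists_simple_submodule R E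
  obtain ⟨E', hE'⟩ := exists_isCompl S
  have eE : E ≃ₗ[R] S × E' := (Submodule.prodEquivOfIsCompl S E' hE').symm
  have : Module.Finite k S := Module.Finite.of_injective
    (S.subtype.restrictScalars k) Subtype.val_injective
  have : Module.Finite k E' := Module.Finite.of_injective
    (E'.subtype.restrictScalars k) Subtype.val_injective
  have : Module.Finite k (S →ₗ[R] S) := .of_injective (LinearMap.restrictScalarsₗ k R S S k)
    (LinearMap.restrictScalars_injective _)
  have hSn : Nontrivial S := IsSimpleModule.nontrivial R S
  -- Testing on `S` itself forces `S` to be a quotient of `F`, hence a summand. Splitting it off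
  -- both sides leaves smaller modules with equal Hom dimensions.
  have hpos : 0 < finrank k (F →ₗ[R] S) := by
    rw [← hT, finrank_hom_of_equiv_prod eE]
    have : 0 < finrank k (S →ₗ[R] S) := finrank_pos
    omega
  have hnt : Nontrivial (F →ₗ[R] S) := nontrivial_of_finrank_pos hpos
  obtain ⟨p, hp⟩ := exists_ne (0 : F →ₗ[R] S)
  have hps : Function.Surjective p := LinearMap.surjective_of_ne_zero hp
  obtain ⟨C, hC⟩ := exists_isCompl (LinearMap.ker p)
  have eC : C ≃ₗ[R] S := (Submodule.quotientEquivOfIsCompl _ C hC).symm.trans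
    (p.quotKerEquivOfSurjective hps)
  have eF : F ≃ₗ[R] S × LinearMap.ker p :=
    (Submodule.prodEquivOfIsCompl C _ hC.symm).symm.trans (eC.prodCongr (.refl R _))
  have : Module.Finite k (LinearMap.ker p) := Module.Finite.of_injective
    ((LinearMap.ker p).subtype.restrictScalars k) Subtype.val_injective
  have h1 := (eE.restrictScalars k).finrank_eq
  have h2 := (eF.restrictScalars k).finrank_eq
  rw [finrank_prod] at h1 h2
  have hSpos : 0 < finrank k S := finrank_pos
  obtain ⟨e⟩ := ih (finrank k E') (by omega) E' (LinearMap.ker p) rfl (by omega) fun T _ _ _ _ _ => by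
    have := hT T
    rw [finrank_hom_of_equiv_prod eE, finrank_hom_of_equiv_prod eF] at this
    omega
  exact ⟨eE.trans (((LinearEquiv.refl R S).prodCongr e).trans eF.symm)⟩

end HomDimension

open Module MonoidAlgebra in
/-- Homomorphisms from a representation to a module over the group algebra. -/
noncomputable def Representation.asModuleHomEquiv {k G V T : Type*} [Field k] [Group G]
    [AddCommGroup V] [Module k V] (ρ : Representation k G V) [AddCommGroup T] [Module k T]
    [Module (MonoidAlgebra k G) T] [IsScalarTower k (MonoidAlgebra k G) T] :
    (ρ.asModule →ₗ[MonoidAlgebra k G] T) ≃ₗ[k] ρ.IntertwiningMap (ofModule' (k := k) (G := G) T) :=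
  have hA : (ofModule' (k := k) (G := G) T).asAlgebraHom = Algebra.lsmul k k T :=
    (MonoidAlgebra.lift k (T →ₗ[k] T) G).apply_symm_apply _
  let e : T ≃ₗ[MonoidAlgebra k G] (ofModule' (k := k) (G := G) T).asModule :=
    { AddEquiv.refl T with
      map_smul' := fun r v => (LinearMap.congr_fun (AlgHom.congr_fun hA r) v).symm }
  have he : ∀ (r : k) (v : T), e (r • v) = r • e v := fun _ _ => rfl
  LinearEquiv.trans
    { toFun := fun f => e.toLinearMap ∘ₗ f
      invFun := fun f => e.symm.toLinearMap ∘ₗ f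
      map_add' := fun _ _ => LinearMap.comp_add _ _ _
      map_smul' := fun r f => LinearMap.ext fun v => he r (f v)
      left_inv := fun _ => LinearMap.ext fun _ => e.symm_apply_apply _
      right_inv := fun _ => LinearMap.ext fun _ => e.apply_symm_apply _ }
    (IntertwiningMap.equivLinearMapAsModule ρ _).symm

open Representation Module MonoidAlgebra in
/-- A representation whose character vanishes away from `1` and has value `|G|` at `1` is
isomorphic to the regular representation. -/
theorem Representation.nonempty_equiv_leftRegular {G V : Type*} [Group G] [Fintype G]
    [AddCommGroup V] [Module ℂ V] [FiniteDimensional ℂ V] (ρ : Representation ℂ G V)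
    (h1 : finrank ℂ V = Nat.card G) (h : ∀ g, g ≠ 1 → ρ.character g = 0) :
    Nonempty (ρ.Equiv (leftRegular ℂ G)) := by
  classical
  have hcard : (Nat.card G : ℂ) ≠ 0 := by
    rw [Nat.card_eq_fintype_card]
    exact_mod_cast Fintype.card_ne_zero
  have : NeZero (Nat.card G : ℂ) := ⟨hcard⟩
  let : Invertible (Nat.card G : ℂ) := invertibleOfNonzero hcard
  have hreg : finrank ℂ (MonoidAlgebra ℂ G) = Nat.card G := by
    rw [(MonoidAlgebra.coeffLinearEquiv ℂ).finrank_eq]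
    simp [Nat.card_eq_fintype_card]
  have : FiniteDimensional ℂ (MonoidAlgebra ℂ G) := inferInstance
  have key := nonempty_linearEquiv_of_finrank_hom_eq (k := ℂ) (R := MonoidAlgebra ℂ G) (Nat.card G)
    ρ.asModule (leftRegular ℂ G).asModule h1 hreg ?_
  · obtain ⟨e⟩ := key
    let f := (IntertwiningMap.equivLinearMapAsModule ρ (leftRegular ℂ G)).symm e.toLinearMap
    exact ⟨Equiv.mk (e.restrictScalars ℂ) f.isIntertwining'⟩
  · intro T _ _ _ _ _
    rw [(asModuleHomEquiv ρ).finrank_eq, (asModuleHomEquiv (leftRegular ℂ G)).finrank_eq,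
      (leftRegularMapEquiv _).finrank_eq]
    -- Only g = 1 survives in the character pairing, so the space of maps to `T` has dimension dim
    -- T, as it does for the regular representation.
    have := card_inv_mul_sum_char_mul_char_eq_finrank ρ (ofModule' (k := ℂ) (G := G) T)
    rw [Finset.sum_eq_single 1, inv_one, char_one, char_one, h1, mul_comm, mul_assoc,
      mul_inv_cancel₀ hcard, mul_one] at this
    · exact_mod_cast this.symm
    · intro g _ hg
      rw [h g⁻¹ (inv_ne_one.2 hg), mul_zero]
    · simp

/-! ### Traces, invariants and the dimension -/

namespace RationalCherednikAlgebra

variable {n : ℕ} {c : ℂ} {E : Type*} [AddCommGroup E] [Module ℂ E]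
  [Module (RationalCherednikAlgebra n 0 c) E] [IsScalarTower ℂ (RationalCherednikAlgebra n 0 c) E]

/-- Nontrivial permutations are traceless on every representation of `H_{0,c}`, `c ≠ 0`. -/
theorem character_permRep_eq_zero (hc : c ≠ 0) {σ : Equiv.Perm (Fin n)} (hσ : σ ≠ 1) :
    (permRep n 0 c E).character σ = 0 := by
  obtain ⟨j, hj⟩ : ∃ j, σ j ≠ j := by
    by_contra! h
    exact hσ (Equiv.ext h)
  have T := isCherednikTriple n c
  set τ := Equiv.swap (σ j) j * σ with hτ
  have hτj : τ j = j := by simp [hτ]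
  have hστ : σ = Equiv.swap (σ j) j * τ := by rw [hτ, ← mul_assoc, Equiv.swap_mul_self, one_mul]
  have key : c • ofPerm n 0 c σ = y n 0 c (σ j) * (ofPerm n 0 c τ * x n 0 c j) -
      x n 0 c j * (y n 0 c (σ j) * ofPerm n 0 c τ) := by
    conv_lhs => rw [hστ, map_mul, ← smul_mul_assoc, ← T.yx_ne _ _ hj]
    rw [T.gx, hτj, sub_mul, mul_assoc, mul_assoc]
  have htr := congrArg (fun a => LinearMap.trace ℂ E (toEnd c E a)) key
  simp only [map_smul, map_sub, map_mul] at htr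
  -- No finiteness is needed: `LinearMap.trace` is zero by default when there is no finite basis.
  rw [← mul_assoc, LinearMap.trace_mul_comm, sub_self] at htr
  exact (smul_eq_zero.1 htr).resolve_left hc

theorem symmetrizer_smul_mem_invariants (v : E) :
    symmetrizer n 0 c • v ∈ (permRep n 0 c E).invariants := by
  intro σ
  change ofPerm n 0 c σ • symmetrizer n 0 c • v = _
  rw [smul_smul, ofPerm_mul_symmetrizer]

theorem symmetrizer_smul_of_mem_invariants {v : E} (hv : v ∈ (permRep n 0 c E).invariants) :
    symmetrizer n 0 c • v = v := by
  have hσ : ∀ σ, ofPerm n 0 c σ • v = v := hv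
  rw [symmetrizer, smul_assoc, Finset.sum_smul]
  simp only [hσ]
  rw [Finset.sum_const, Finset.card_univ, Fintype.card_perm, Fintype.card_fin,
    ← Nat.cast_smul_eq_nsmul ℂ, smul_smul, inv_mul_cancel₀, one_smul]
  exact_mod_cast n.factorial_ne_zero

/-- The space of `S_n`-invariants of an irreducible representation of `H_{0,c}` is at most
one-dimensional. -/
theorem finrank_invariants_le_one [IsSimpleModule (RationalCherednikAlgebra n 0 c) E] :
    Module.finrank ℂ (permRep n 0 c E).invariants ≤ 1 := by
  have : Module.Finite ℂ E := finite_of_isSimpleModule (n := n) (c := c)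
  set e := symmetrizer n 0 c with he
  rcases subsingleton_or_nontrivial (permRep n 0 c E).invariants with hs | hn
  · rw [Module.finrank_zero_of_subsingleton]
    exact zero_le_one
  have hgen : ∀ u : E, u ≠ 0 → ∀ v, ∃ b : RationalCherednikAlgebra n 0 c, b • u = v :=
    fun u hu v => IsSimpleModule.toSpanSingleton_surjective (RationalCherednikAlgebra n 0 c) hu v
  have hscalar : ∀ a : RationalCherednikAlgebra n 0 c, ∃ r : ℂ,
      ∀ v ∈ (permRep n 0 c E).invariants, e • a • v = r • v := by
    intro a
    let L : Module.End ℂ (permRep n 0 c E).invariants :=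
      (toEnd c E (e * a)).restrict fun v _ => by
        change (e * a) • v ∈ _
        rw [mul_smul]
        exact symmetrizer_smul_mem_invariants _
    obtain ⟨r, hr⟩ := Module.End.exists_eigenvalue L
    obtain ⟨⟨u, hu⟩, hur⟩ := hr.exists_hasEigenvector
    have hu0 : u ≠ 0 := fun h => hur.2 (Subtype.ext h)
    have hLu : (e * a) • u = r • u := congrArg Subtype.val hur.apply_eq_smul
    refine ⟨r, fun v hv => ?_⟩
    obtain ⟨b, rfl⟩ := hgen u hu0 v
    -- Both `u` and `b • u` are invariant, so b may be replaced by ebe, which commutes with eae; the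
    -- eigenvalue at `u` thus propagates to all invariants.
    have h1 : b • u = (e * b * e) • u := by
      rw [mul_smul, mul_smul, symmetrizer_smul_of_mem_invariants hu,
        symmetrizer_smul_of_mem_invariants hv]
    calc e • a • b • u = (e * a * e * b * e) • u := by
          rw [h1]; simp only [mul_smul]
      _ = (e * b * e) • (e * a) • u := by
          rw [spherical_comm]
          simp only [mul_smul]
          rw [symmetrizer_smul_of_mem_invariants hu, symmetrizer_smul_of_mem_invariants
            (symmetrizer_smul_mem_invariants _)]
      _ = r • b • u := by
          rw [hLu, h1, smul_comm]
  obtain ⟨⟨u, hu⟩, hu0⟩ := exists_ne (0 : (permRep n 0 c E).invariants)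
  refine finrank_le_one ⟨u, hu⟩ fun ⟨w, hw⟩ => ?_
  obtain ⟨b, hb⟩ := hgen u (fun h => hu0 (Subtype.ext h)) w
  obtain ⟨r, hr⟩ := hscalar b
  refine ⟨r, Subtype.ext ?_⟩
  change r • u = w
  rw [← hr u hu, hb, symmetrizer_smul_of_mem_invariants hw]

/-- Averaging the character gives dim E = n! · dim E^{S_n}; the second factor is at most one, and it
is not zero because `E` is not. -/
theorem finrank_eq_factorial (hc : c ≠ 0) [IsSimpleModule (RationalCherednikAlgebra n 0 c) E] :
    Module.finrank ℂ E = n.factorial := by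
  have : Module.Finite ℂ E := finite_of_isSimpleModule (n := n) (c := c)
  have : Nontrivial E := IsSimpleModule.nontrivial (RationalCherednikAlgebra n 0 c) E
  have hcard : Nat.card (Equiv.Perm (Fin n)) = n.factorial := by
    rw [Nat.card_eq_fintype_card, Fintype.card_perm, Fintype.card_fin]
  have hn : (Nat.card (Equiv.Perm (Fin n)) : ℂ) ≠ 0 := by
    rw [hcard]
    exact_mod_cast n.factorial_ne_zero
  let : Invertible (Nat.card (Equiv.Perm (Fin n)) : ℂ) := invertibleOfNonzero hn
  have h := Representation.card_inv_mul_sum_char_eq_finrank (permRep n 0 c E)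
  rw [Finset.sum_eq_single 1 (fun σ _ hσ => character_permRep_eq_zero hc hσ) (by simp),
    Representation.char_one, inv_mul_eq_iff_eq_mul₀ hn, hcard] at h
  have h' : Module.finrank ℂ E =
      n.factorial * Module.finrank ℂ (permRep n 0 c E).invariants := by exact_mod_cast h
  have hpos : 0 < Module.finrank ℂ E := Module.finrank_pos
  have hle := finrank_invariants_le_one (n := n) (c := c) (E := E)
  interval_cases hd : Module.finrank ℂ (permRep n 0 c E).invariants <;> omega

end RationalCherednikAlgebra

theorem mainTheorem4 (n : ℕ) (c : ℂ) (hc : c ≠ 0)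
    (E : Type*) [AddCommGroup E] [Module ℂ E] [Module (RationalCherednikAlgebra n 0 c) E]
    [IsScalarTower ℂ (RationalCherednikAlgebra n 0 c) E]
    [IsSimpleModule (RationalCherednikAlgebra n 0 c) E] :
    Module.Finite ℂ E ∧ Module.finrank ℂ E = n.factorial ∧
      Nonempty ((RationalCherednikAlgebra.permRep n 0 c E).Equiv
        (Representation.leftRegular ℂ (Equiv.Perm (Fin n)))) := by
  have hfin : Module.Finite ℂ E := RationalCherednikAlgebra.finite_of_isSimpleModule (n := n) (c := c)
  have hdim : Module.finrank ℂ E = n.factorial :=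
    RationalCherednikAlgebra.finrank_eq_factorial (c := c) hc
  refine ⟨hfin, hdim, Representation.nonempty_equiv_leftRegular _ ?_ fun σ hσ =>
    RationalCherednikAlgebra.character_permRep_eq_zero hc hσ⟩
  rw [hdim, Nat.card_eq_fintype_card, Fintype.card_perm, Fintype.card_fin]
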